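/- **Setting.** Let $\Omega$ be a set (of any cardinality) whose points are the atoms of a partition; events are the subsets of $\Omega$. Let $P_0$ be a finitely additive probability on the powerset of $\Omega$, let $b>0$, $a\le 0$, $0\le a+b\le 1$, $c=1-(a+b)$. The Vertical Barrier Model (VBM) given by $P_0,a,b$ is the pair $$\underline P(A)=\max\{bP_0(A)+a,0\}\ (A\ne\Omega),\quad \underline P(\Omega)=1,\qquad \overline P(A)=\min\{bP_0(A)+c,1\}\ (A\neq\emptyset),\quad \overline P(\emptyset)=0 .$$ For $B\ne\emptyset$ let $\underline E(A|B)$ and $\overline E(A|B)$ be the (conditional) natural extensions, i.e. the infimum and the supremum of $P(A|B)$ over all finitely additive conditional probabilities $P$, defined on the events $C$ and the conditional events $C|B$ (with $P(B|B)=1$ and $P(C\wedge B)=P(C|B)P(B)$ for all $C$; $P(B)=0$ is allowed), such that $P(C)\ge\underline P(C)$ for every event $C$. Let $\mathfrak B$ be a (finite or infinite) partition of $\Omega$ into non-empty events. It strictly dilates $A$ if $\underline E(A|B)<\underline P(A)\le\overline P(A)<\overline E(A|B)$ for all $B\in\mathfrak B$. The extent of dilation is $$\Delta(A,\mathfrak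 B)=\inf_{B\in\mathfrak B}\{\overline E(A|B)-\underline E(A|B)-(\overline P(A)-\underline P(A))\}.$$ Put $\mathfrak B_{>0}=\{B\in\mathfrak B:\underline P(B)>0\}$ and $$\mathfrak B_A^+=\{B\in\mathfrak B_{>0}:\underline E(A|B),\overline E(A|B)\in\,]0,1[\},$$ $$\mathfrak B_A^1=\{B\in\mathfrak B_{>0}:\underline E(A|B)\in\,]0,1[,\ \overline E(A|B)=1\},\qquad \mathfrak B_A^0=\{B\in\mathfrak B_{>0}:\underline E(A|B)=0,\ \overline E(A|B)\in\,]0,1[\}.$$ **Theorem.** Let $(\underline P,\overline P)$ be a VBM and let $\mathfrak B$ strictly dilate $A$. If $\mathfrak B_A^+\ne\emptyset$, then $P_0$ attains its maximum over $\mathfrak B_A^+$; the numbers $$M_0=\sup_{B\in\mathfrak B_A^0}\frac{\underline P(\neg A\wedge B)}{\overline P(A\wedge B)},\qquad M_1=\sup_{B\in\mathfrak B_A^1}\frac{\underline P(A\wedge B)}{\overline P(\neg A\wedge B)}$$ have positive denominators and, when the respective index set is non-empty, are finite; and for every $B^*\in\mathfrak B_A^+$ with $P_0(B^*)=\max_{B\in\mathfrak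 B_A^+}P_0(B)$, $$\Delta(A,\mathfrak B)=\underline P(A)-\overline P(A)+\min\Big\{1,\ \overline E(A|B^*)-\underline E(A|B^*),\ \frac1{1+M_0},\ \frac1{1+M_1}\Big\},$$ where, if any of $\mathfrak B_A^+,\mathfrak B_A^0,\mathfrak B_A^1$ is empty, the corresponding term (the second, third, fourth, respectively) is omitted from the minimum. -/

import Mathlib

/-!
The atoms of the underlying partition are the points of a type `Ω`, of arbitrary cardinality;
the events logically dependent on that partition are the subsets of `Ω`.
-/

/-- A (precise, finitely additive) probability on the powerset of `Ω`. -/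
structure FinAddProb (Ω : Type*) where
  toFun : Set Ω → ℝ
  nonneg' : ∀ A, 0 ≤ toFun A
  univ' : toFun Set.univ = 1
  union' : ∀ A B, Disjoint A B → toFun (A ∪ B) = toFun A + toFun B

instance {Ω : Type*} : CoeFun (FinAddProb Ω) (fun _ => Set Ω → ℝ) := ⟨FinAddProb.toFun⟩

/-- `P` on the events `A` and `Q` on the conditional events `A | B` (for the given `B`) together
form a precise conditional probability in the sense of de Finetti. There is no condition
`P B > 0`, and `Q` is then not determined by `P`. For `B = ∅` no such pair exists. -/
structure IsPreciseCond {Ω : Type*} (B : Set Ω) (P Q : FinAddProb Ω) : Prop where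
  self : Q B = 1
  product_rule : ∀ A, P (A ∩ B) = Q A * P B

/-- The values `P(A|B)`, as `P` ranges over the precise conditional probabilities defined on all
events `C` and all conditional events `C | B` that dominate the lower probability `lpr`. -/
def credalValues {Ω : Type*} (lpr : Set Ω → ℝ) (A B : Set Ω) : Set ℝ :=
  {x | ∃ P Q : FinAddProb Ω, IsPreciseCond B P Q ∧ (∀ C, lpr C ≤ P C) ∧ x = Q A}

/-- The natural extension `E̲(A|B)` of the lower probability `lpr`: the lower envelope of the
credal set. -/
noncomputable def lowerExt {Ω : Type*} (lpr : Set Ω → ℝ) (A B : Set Ω) : ℝ :=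
  sInf (credalValues lpr A B)

/-- The natural extension `E̅(A|B)` of the upper probability conjugate to `lpr`: the upper
envelope of the same credal set. -/
noncomputable def upperExt {Ω : Type*} (lpr : Set Ω → ℝ) (A B : Set Ω) : ℝ :=
  sSup (credalValues lpr A B)

/-- The parameters of a Vertical Barrier Model on the powerset of `Ω`. -/
structure VBM (Ω : Type*) where
  P₀ : FinAddProb Ω
  a : ℝ
  b : ℝ
  b_pos : 0 < b
  a_nonpos : a ≤ 0
  add_nonneg : 0 ≤ a + b
  add_le_one : a + b ≤ 1

namespace VBM

variable {Ω : Type*} (V : VBM Ω)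

/-- `c = 1 - (a + b)`. -/
def c : ℝ := 1 - (V.a + V.b)

open Classical in
/-- The lower probability of the model. -/
noncomputable def lpr (A : Set Ω) : ℝ :=
  if A = Set.univ then 1 else max (V.b * V.P₀ A + V.a) 0

open Classical in
/-- The upper probability of the model. -/
noncomputable def upr (A : Set Ω) : ℝ :=
  if A = ∅ then 0 else min (V.b * V.P₀ A + V.c) 1

/-- `E̲(A|B)`. -/
noncomputable def lpe (A B : Set Ω) : ℝ := lowerExt V.lpr A B

/-- `E̅(A|B)`. -/
noncomputable def upe (A B : Set Ω) : ℝ := upperExt V.lpr A B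

/-- The partition `𝔅` strictly dilates `A`. -/
def StrictlyDilates (𝔅 : Set (Set Ω)) (A : Set Ω) : Prop :=
  ∀ B ∈ 𝔅, V.lpe A B < V.lpr A ∧ V.lpr A ≤ V.upr A ∧ V.upr A < V.upe A B

/-- The imprecision variation `Δ(A,B)`. -/
noncomputable def imprecisionVariation (A B : Set Ω) : ℝ :=
  (V.upe A B - V.lpe A B) - (V.upr A - V.lpr A)

/-- The extent of dilation `Δ(A,𝔅)`. -/
noncomputable def extentOfDilation (A : Set Ω) (𝔅 : Set (Set Ω)) : ℝ :=
  ⨅ B : 𝔅, V.imprecisionVariation A B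

/-- The atoms of `𝔅` with positive lower probability. -/
def posAtoms (𝔅 : Set (Set Ω)) : Set (Set Ω) := {B ∈ 𝔅 | 0 < V.lpr B}

/-- `𝔅_A^+`. -/
def plusAtoms (A : Set Ω) (𝔅 : Set (Set Ω)) : Set (Set Ω) :=
  {B ∈ V.posAtoms 𝔅 | V.lpe A B ∈ Set.Ioo 0 1 ∧ V.upe A B ∈ Set.Ioo 0 1}

/-- `𝔅_A^1`. -/
def oneAtoms (A : Set Ω) (𝔅 : Set (Set Ω)) : Set (Set Ω) :=
  {B ∈ V.posAtoms 𝔅 | V.lpe A B ∈ Set.Ioo 0 1 ∧ V.upe A B = 1}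

/-- `𝔅_A^0`. -/
def zeroAtoms (A : Set Ω) (𝔅 : Set (Set Ω)) : Set (Set Ω) :=
  {B ∈ V.posAtoms 𝔅 | V.lpe A B = 0 ∧ V.upe A B ∈ Set.Ioo 0 1}

/-- `Bstar` maximises `P₀` over `𝔅_A^+`. -/
def IsPlusMax (A : Set Ω) (𝔅 : Set (Set Ω)) (Bstar : Set Ω) : Prop :=
  Bstar ∈ V.plusAtoms A 𝔅 ∧ ∀ B ∈ V.plusAtoms A 𝔅, V.P₀ B ≤ V.P₀ Bstar

/-- The ratios whose supremum is `M₀`. -/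
def ratios₀ (A : Set Ω) (𝔅 : Set (Set Ω)) : Set ℝ :=
  (fun B => V.lpr (Aᶜ ∩ B) / V.upr (A ∩ B)) '' V.zeroAtoms A 𝔅

/-- The ratios whose supremum is `M₁`. -/
def ratios₁ (A : Set Ω) (𝔅 : Set (Set Ω)) : Set ℝ :=
  (fun B => V.lpr (A ∩ B) / V.upr (Aᶜ ∩ B)) '' V.oneAtoms A 𝔅

noncomputable def M₀ (A : Set Ω) (𝔅 : Set (Set Ω)) : ℝ := sSup (V.ratios₀ A 𝔅)

noncomputable def M₁ (A : Set Ω) (𝔅 : Set (Set Ω)) : ℝ := sSup (V.ratios₁ A 𝔅)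

/-- The numbers `1`, `E̅(A|B*) - E̲(A|B*)`, `1/(1+M₀)`, `1/(1+M₁)`, where a term is left out if
the corresponding set of atoms is empty. -/
def extentTerms (A : Set Ω) (𝔅 : Set (Set Ω)) (Bstar : Set Ω) : Set ℝ :=
  {t | t = 1 ∨
    ((V.plusAtoms A 𝔅).Nonempty ∧ t = V.upe A Bstar - V.lpe A Bstar) ∨
    ((V.zeroAtoms A 𝔅).Nonempty ∧ t = 1 / (1 + V.M₀ A 𝔅)) ∨
    ((V.oneAtoms A 𝔅).Nonempty ∧ t = 1 / (1 + V.M₁ A 𝔅))}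

end VBM

/-! Dilation forces `A ∩ B` and `Aᶜ ∩ B` to be non-empty. If `B` has lower probability zero, some
dominating `P` has `P B = 0`, the conditional is then free on `B`, and the imprecision has width 1.
If it is positive, `P(A|B)` is `x / (x + y)` with `x = P (A ∩ B)`, `y = P (Aᶜ ∩ B)`, increasing in
`x` and decreasing in `y`. One dominating `P` attains the lower bound of one piece and the upper
bound of the other, so both extensions are explicit fractions.

On `plusAtoms` no barrier is active and the width is `(c - a) / (b P₀(B) + a + c)`, smallest where
`P₀` is largest. On `zeroAtoms` and `oneAtoms` it is `1 / (1 + ratio)`, with infimum `1 / (1 +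
sup)`. The extent is the least of these infima, up to the constant width of `A`. -/

/-! ### Finitely additive probabilities -/

namespace FinAddProb

variable {Ω : Type*} (P : FinAddProb Ω)

lemma apply_empty : P ∅ = 0 := by
  have h := P.union' ∅ ∅ (by simp)
  simp only [Set.union_self] at h
  linarith

lemma nonempty (P : FinAddProb Ω) : Nonempty Ω := by
  by_contra h
  rw [not_nonempty_iff] at h
  have h₁ := P.univ'
  rw [Set.univ_eq_empty_iff.2 h, P.apply_empty] at h₁
  exact zero_ne_one h₁

lemma inter_add_compl (A B : Set Ω) : P (A ∩ B) + P (Aᶜ ∩ B) = P B := by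
  rw [← P.union' _ _ (by
    exact (disjoint_compl_right (a := A)).mono Set.inter_subset_left Set.inter_subset_left),
    ← Set.union_inter_distrib_right, Set.union_compl_self, Set.univ_inter]

lemma compl (A : Set Ω) : P Aᶜ = 1 - P A := by
  have h := P.inter_add_compl A Set.univ
  simp only [Set.inter_univ, P.univ'] at h
  linarith

lemma mono {A B : Set Ω} (h : A ⊆ B) : P A ≤ P B := by
  have h₁ := P.inter_add_compl A B
  rw [Set.inter_eq_left.2 h] at h₁
  linarith [P.nonneg' (Aᶜ ∩ B)]

lemma le_one (A : Set Ω) : P A ≤ 1 := P.univ' ▸ P.mono (Set.subset_univ A)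

lemma sum_le_one_of_pairwiseDisjoint (S : Finset (Set Ω))
    (hS : (S : Set (Set Ω)).PairwiseDisjoint id) : ∑ B ∈ S, P B ≤ 1 := by
  suffices h : ∑ B ∈ S, P B = P (⋃ B ∈ S, B) from h ▸ P.le_one _
  classical
  induction S using Finset.induction_on with
  | empty => simp [P.apply_empty]
  | insert B S hB ih =>
    rw [Finset.sum_insert hB, ih (hS.subset (by simp)), ← P.union']
    · simp
    · simp only [Set.disjoint_iUnion_right]
      intro C hC
      exact hS (by simp) (by simp [hC]) (by rintro rfl; exact hB hC)

/-- Among pairwise disjoint events, only finitely many have probability at least a given positive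
number. -/
lemma finite_setOf_le {S : Set (Set Ω)} (hS : S.PairwiseDisjoint id) {p : ℝ} (hp : 0 < p) :
    {B ∈ S | p ≤ P B}.Finite := by
  by_contra h
  obtain ⟨n, hn⟩ := exists_nat_gt (1 / p)
  obtain ⟨T, hT, hTn⟩ := Set.Infinite.exists_subset_card_eq h n
  have h₁ := P.sum_le_one_of_pairwiseDisjoint T (hS.subset fun B hB => (hT hB).1)
  have h₂ := Finset.card_nsmul_le_sum T (fun B => P B) p fun B hB => (hT hB).2
  rw [hTn, nsmul_eq_mul] at h₂
  rw [div_lt_iff₀ hp] at hn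
  linarith

lemma exists_max_of_pairwiseDisjoint {S : Set (Set Ω)} (hS : S.PairwiseDisjoint id)
    (hpos : ∃ B ∈ S, 0 < P B) : ∃ B ∈ S, ∀ C ∈ S, P C ≤ P B := by
  obtain ⟨B₀, hB₀, hp⟩ := hpos
  -- Only the finitely many events at least as probable as `B₀` compete.
  obtain ⟨B, hB, hmax⟩ := Set.exists_max_image _ (fun B => P B) (P.finite_setOf_le hS hp)
    ⟨B₀, hB₀, le_rfl⟩
  refine ⟨B, hB.1, fun C hC => ?_⟩
  rcases le_total (P B₀) (P C) with h | h
  · exact hmax C ⟨hC, h⟩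
  · exact h.trans hB.2

open Classical in
/-- The probability concentrated at a point. -/
noncomputable def dirac (ω : Ω) : FinAddProb Ω where
  toFun C := if ω ∈ C then 1 else 0
  nonneg' C := by split_ifs <;> norm_num
  univ' := by simp
  union' A B h := by
    have : ω ∈ A → ω ∉ B := fun h₁ h₂ => Set.disjoint_left.1 h h₁ h₂
    by_cases h₁ : ω ∈ A <;> by_cases h₂ : ω ∈ B <;> simp_all

lemma dirac_of_mem {ω : Ω} {C : Set Ω} (h : ω ∈ C) : dirac ω C = 1 := if_pos h

lemma dirac_of_notMem {ω : Ω} {C : Set Ω} (h : ω ∉ C) : dirac ω C = 0 := if_neg h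

/-- Conditioning on an event of positive probability. -/
noncomputable def cond (B : Set Ω) (hB : 0 < P B) : FinAddProb Ω where
  toFun C := P (C ∩ B) / P B
  nonneg' C := div_nonneg (P.nonneg' _) hB.le
  univ' := by rw [Set.univ_inter, div_self hB.ne']
  union' C D h := by
    rw [Set.union_inter_distrib_right,
      P.union' _ _ (h.mono Set.inter_subset_left Set.inter_subset_left), add_div]

lemma isPreciseCond_cond (B : Set Ω) (hB : 0 < P B) : IsPreciseCond B P (P.cond B hB) where
  self := by
    change P (B ∩ B) / P B = 1
    rw [Set.inter_self, div_self hB.ne']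
  product_rule C := (div_mul_cancel₀ _ hB.ne').symm

/-- On a null `B` the product rule reads `0 = 0`; this is the source of vacuous conditionals. -/
lemma isPreciseCond_dirac {B : Set Ω} (hB : P B = 0) {ω : Ω} (hω : ω ∈ B) :
    IsPreciseCond B P (dirac ω) where
  self := dirac_of_mem hω
  product_rule C := by
    rw [hB, mul_zero]
    exact le_antisymm (hB ▸ P.mono Set.inter_subset_right) (P.nonneg' _)

lemma add_add_compl_union {X Y : Set Ω} (h : Disjoint X Y) (C : Set Ω) :
    P (C ∩ X) + P (C ∩ Y) + P (C ∩ (X ∪ Y)ᶜ) = P C := by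
  rw [← P.union' _ _ (h.mono Set.inter_subset_right Set.inter_subset_right),
    ← Set.inter_union_distrib_left, Set.inter_comm C, Set.inter_comm C, P.inter_add_compl]

end FinAddProb

/-! ### Conditional probabilities and conjugacy -/

namespace IsPreciseCond

variable {Ω : Type*} {B : Set Ω} {P Q : FinAddProb Ω}

lemma eq_div (h : IsPreciseCond B P Q) (hB : 0 < P B) (A : Set Ω) :
    Q A = P (A ∩ B) / (P (A ∩ B) + P (Aᶜ ∩ B)) := by
  rw [P.inter_add_compl, eq_div_iff hB.ne', h.product_rule]

lemma inter_right (h : IsPreciseCond B P Q) (A : Set Ω) : Q (A ∩ B) = Q A := by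
  have h₁ : Q Bᶜ = 0 := by rw [Q.compl, h.self, sub_self]
  have h₂ := Q.inter_add_compl B A
  have h₃ := Q.mono (A := Bᶜ ∩ A) (B := Bᶜ) Set.inter_subset_left
  have h₄ := Q.nonneg' (Bᶜ ∩ A)
  rw [Set.inter_comm]
  linarith

end IsPreciseCond

lemma div_add_le_div_add {u v u' v' : ℝ} (hu : 0 ≤ u) (huu : u ≤ u') (hv : 0 ≤ v') (hvv : v' ≤ v)
    (hpos : 0 < u' + v') : u / (u + v) ≤ u' / (u' + v') := by
  rcases (add_nonneg hu (hv.trans hvv)).eq_or_lt with h | h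
  · rw [← h, div_zero]
    exact div_nonneg (hu.trans huu) hpos.le
  · rw [div_le_div_iff₀ h hpos]
    nlinarith [mul_le_mul huu hvv hv (hu.trans huu)]

lemma credalValues_compl {Ω : Type*} (lpr : Set Ω → ℝ) {A B : Set Ω} {x : ℝ} :
    x ∈ credalValues lpr Aᶜ B ↔ 1 - x ∈ credalValues lpr A B := by
  constructor
  · rintro ⟨P, Q, h, hP, rfl⟩
    exact ⟨P, Q, h, hP, by rw [Q.compl]; ring⟩
  · rintro ⟨P, Q, h, hP, hx⟩
    exact ⟨P, Q, h, hP, by rw [Q.compl, ← hx]; ring⟩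

lemma isGreatest_credalValues_of_compl {Ω : Type*} {lpr : Set Ω → ℝ} {A B : Set Ω} {x : ℝ}
    (h : IsLeast (credalValues lpr Aᶜ B) (1 - x)) : IsGreatest (credalValues lpr A B) x := by
  refine ⟨by simpa using (credalValues_compl lpr).1 h.1, fun y hy => ?_⟩
  have hy' : 1 - y ∈ credalValues lpr Aᶜ B := (credalValues_compl lpr).2 (by simpa using hy)
  have := h.2 hy'
  linarith

/-! ### The credal set of a VBM -/

namespace VBM

variable {Ω : Type*} (V : VBM Ω)

lemma c_nonneg : 0 ≤ V.c := by
  have := V.add_le_one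
  unfold c
  linarith

lemma lpr_of_ne_univ {C : Set Ω} (h : C ≠ Set.univ) :
    V.lpr C = max (V.b * V.P₀ C + V.a) 0 := if_neg h

lemma upr_of_nonempty {C : Set Ω} (h : C.Nonempty) :
    V.upr C = min (V.b * V.P₀ C + V.c) 1 := if_neg h.ne_empty

lemma lpr_nonneg (C : Set Ω) : 0 ≤ V.lpr C := by
  unfold lpr
  split_ifs
  · exact zero_le_one
  · exact le_max_right _ _

lemma upr_le_one (C : Set Ω) : V.upr C ≤ 1 := by
  unfold upr
  split_ifs
  · exact zero_le_one
  · exact min_le_right _ _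

lemma upr_nonneg (C : Set Ω) : 0 ≤ V.upr C := by
  unfold upr
  split_ifs
  · exact le_rfl
  · exact le_min (_root_.add_nonneg (mul_nonneg V.b_pos.le (V.P₀.nonneg' C)) V.c_nonneg) zero_le_one

lemma upr_eq_one_sub_lpr_compl (C : Set Ω) : V.upr C = 1 - V.lpr Cᶜ := by
  rcases C.eq_empty_or_nonempty with rfl | h
  · simp [upr, lpr]
  · have h' : Cᶜ ≠ Set.univ := by simpa [Set.compl_univ_iff] using h.ne_empty
    rw [V.upr_of_nonempty h, V.lpr_of_ne_univ h', V.P₀.compl, c, ← sub_zero (1 : ℝ),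
      ← min_sub_sub_left]
    congr 1 <;> ring

/-- Redistributing the mass `a + b` over three pieces, with densities at most `b` with respect to
`P₀`, and putting the remaining mass `c` at a point gives an element of the credal set. -/
lemma exists_dominating {X Y : Set Ω} (hXY : Disjoint X Y) (ω : Ω) {u v w : ℝ}
    (hu : 0 ≤ u) (hu' : u ≤ V.b * V.P₀ X) (hv : 0 ≤ v) (hv' : v ≤ V.b * V.P₀ Y)
    (hw : 0 ≤ w) (hw' : w ≤ V.b * V.P₀ (X ∪ Y)ᶜ) (hsum : u + v + w = V.a + V.b) :
    ∃ P : FinAddProb Ω, (∀ C, V.lpr C ≤ P C) ∧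
      P X = u + V.c * FinAddProb.dirac ω X ∧ P Y = v + V.c * FinAddProb.dirac ω Y := by
  have slope : ∀ {D : Set Ω} {m : ℝ}, 0 ≤ m → m ≤ V.b * V.P₀ D →
      ∃ s, 0 ≤ s ∧ s ≤ V.b ∧ s * V.P₀ D = m := by
    intro D m h₀ h₁
    rcases (V.P₀.nonneg' D).eq_or_lt with h | h
    · exact ⟨0, le_rfl, V.b_pos.le, by rw [← h, mul_zero] at h₁; linarith⟩
    · exact ⟨m / V.P₀ D, div_nonneg h₀ h.le, (div_le_iff₀ h).2 h₁, div_mul_cancel₀ _ h.ne'⟩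
  obtain ⟨s, hs, hsb, rfl⟩ := slope hu hu'
  obtain ⟨t, ht, htb, rfl⟩ := slope hv hv'
  obtain ⟨r, hr, hrb, rfl⟩ := slope hw hw'
  have nn := V.P₀.nonneg'
  have hc := V.c_nonneg
  have hpos : ∀ C, 0 ≤ s * V.P₀ (C ∩ X) + t * V.P₀ (C ∩ Y) + r * V.P₀ (C ∩ (X ∪ Y)ᶜ) +
      V.c * FinAddProb.dirac ω C := fun C =>
    _root_.add_nonneg (_root_.add_nonneg (_root_.add_nonneg (mul_nonneg hs (nn _)) (mul_nonneg ht (nn _)))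
      (mul_nonneg hr (nn _))) (mul_nonneg hc ((FinAddProb.dirac ω).nonneg' C))
  let P : FinAddProb Ω :=
    { toFun := fun C => s * V.P₀ (C ∩ X) + t * V.P₀ (C ∩ Y) + r * V.P₀ (C ∩ (X ∪ Y)ᶜ) +
        V.c * FinAddProb.dirac ω C
      nonneg' := hpos
      univ' := by
        rw [Set.univ_inter, Set.univ_inter, Set.univ_inter, hsum, (FinAddProb.dirac ω).univ', c]
        ring
      union' := by
        intro C D h
        simp only [Set.union_inter_distrib_right]
        rw [V.P₀.union' _ _ (h.mono Set.inter_subset_left Set.inter_subset_left),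
          V.P₀.union' _ _ (h.mono Set.inter_subset_left Set.inter_subset_left),
          V.P₀.union' _ _ (h.mono Set.inter_subset_left Set.inter_subset_left),
          (FinAddProb.dirac ω).union' _ _ h]
        ring }
  refine ⟨P, fun C => ?_, ?_, ?_⟩
  · by_cases hC : C = Set.univ
    · subst hC
      rw [P.univ', lpr, if_pos rfl]
    · rw [V.lpr_of_ne_univ hC]
      refine max_le ?_ (hpos C)
      have e₁ := V.P₀.add_add_compl_union hXY C
      have e₂ := V.P₀.add_add_compl_union hXY Set.univ
      simp only [Set.univ_inter, V.P₀.univ'] at e₂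
      -- Relative to `b * P₀`, the loss on `C` is at most the total loss `b - (a + b) = -a`.
      have m₁ := mul_le_mul_of_nonneg_left
        (V.P₀.mono (Set.inter_subset_right : C ∩ X ⊆ X)) (sub_nonneg.2 hsb)
      have m₂ := mul_le_mul_of_nonneg_left
        (V.P₀.mono (Set.inter_subset_right : C ∩ Y ⊆ Y)) (sub_nonneg.2 htb)
      have m₃ := mul_le_mul_of_nonneg_left
        (V.P₀.mono (Set.inter_subset_right : C ∩ (X ∪ Y)ᶜ ⊆ (X ∪ Y)ᶜ)) (sub_nonneg.2 hrb)
      have m₄ := mul_nonneg hc ((FinAddProb.dirac ω).nonneg' C)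
      have e₃ := congrArg (V.b * ·) e₁
      have e₄ := congrArg (V.b * ·) e₂
      change _ ≤ s * V.P₀ (C ∩ X) + t * V.P₀ (C ∩ Y) + r * V.P₀ (C ∩ (X ∪ Y)ᶜ) +
        V.c * FinAddProb.dirac ω C
      linarith
  · change s * V.P₀ (X ∩ X) + t * V.P₀ (X ∩ Y) + r * V.P₀ (X ∩ (X ∪ Y)ᶜ) + _ = _
    have h : X ∩ (X ∪ Y)ᶜ = ∅ := by ext; simp; tauto
    rw [Set.inter_self, hXY.inter_eq, h, V.P₀.apply_empty]
    ring
  · change s * V.P₀ (Y ∩ X) + t * V.P₀ (Y ∩ Y) + r * V.P₀ (Y ∩ (X ∪ Y)ᶜ) + _ = _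
    have h : Y ∩ (X ∪ Y)ᶜ = ∅ := by ext; simp; tauto
    rw [Set.inter_self, hXY.symm.inter_eq, h, V.P₀.apply_empty]
    ring

/-- On two disjoint events, the lower probability of the first and the upper probability of the
second are attained simultaneously in the credal set. -/
lemma exists_dominating_eq_lpr_upr {X Y : Set Ω} (hXY : Disjoint X Y) (hY : Y.Nonempty) :
    ∃ P : FinAddProb Ω, (∀ C, V.lpr C ≤ P C) ∧ P X = V.lpr X ∧ P Y = V.upr Y := by
  obtain ⟨ω, hω⟩ := hY
  have hX : X ≠ Set.univ := by
    rintro rfl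
    exact Set.disjoint_left.1 hXY (Set.mem_univ ω) hω
  have e := V.P₀.add_add_compl_union hXY Set.univ
  simp only [Set.univ_inter, V.P₀.univ'] at e
  have hx := V.P₀.nonneg' X
  have hy := V.P₀.nonneg' Y
  have hz := V.P₀.nonneg' (X ∪ Y)ᶜ
  have ha := V.a_nonpos
  have hab := V.add_nonneg
  have eb : V.b * V.P₀ X + V.b * V.P₀ Y + V.b * V.P₀ (X ∪ Y)ᶜ = V.b := by
    rw [← mul_add, ← mul_add, e, mul_one]
  have bx := mul_nonneg V.b_pos.le hx
  have byy := mul_nonneg V.b_pos.le hy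
  have bz := mul_nonneg V.b_pos.le hz
  obtain ⟨P, hP, hPX, hPY⟩ := V.exists_dominating hXY ω
    -- Here `u` is the lower probability of `X`, `v` is the upper probability of `Y` minus the point
    -- mass `c` at `ω ∈ Y`, and `w` is the rest of `a + b`.
    (u := max (V.b * V.P₀ X + V.a) 0)
    (v := V.a + V.b - max (V.b - V.b * V.P₀ Y + V.a) 0)
    (w := max (V.b - V.b * V.P₀ Y + V.a) 0 - max (V.b * V.P₀ X + V.a) 0)
    (le_max_right _ _) (max_le (by linarith) bx)
    (sub_nonneg.2 (max_le (by linarith) hab))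
    (by linarith [le_max_left (V.b - V.b * V.P₀ Y + V.a) 0])
    (sub_nonneg.2 (max_le_max (by linarith) le_rfl))
    (by
      rw [sub_le_iff_le_add]
      refine max_le ?_ ?_
      · linarith [le_max_left (V.b * V.P₀ X + V.a) 0]
      · linarith [le_max_right (V.b * V.P₀ X + V.a) 0])
    (by ring)
  refine ⟨P, hP, ?_, ?_⟩
  · rw [hPX, FinAddProb.dirac_of_notMem (fun h => Set.disjoint_left.1 hXY h hω),
      V.lpr_of_ne_univ hX]
    ring
  · rw [hPY, FinAddProb.dirac_of_mem hω, V.upr_eq_one_sub_lpr_compl,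
      V.lpr_of_ne_univ (by simpa [Set.compl_univ_iff] using Set.nonempty_iff_ne_empty.1 ⟨ω, hω⟩),
      V.P₀.compl, c, mul_one, mul_one_sub]
    ring

/-- Lower probability zero means `b * P₀ Bᶜ ≥ a + b`, so `Bᶜ` can carry the mass `a + b` as well as
the point mass `c`. -/
lemma exists_dominating_eq_zero {B : Set Ω} (hB : V.lpr B = 0) :
    ∃ P : FinAddProb Ω, (∀ C, V.lpr C ≤ P C) ∧ P B = 0 := by
  have hne : B ≠ Set.univ := by
    rintro rfl
    simp [lpr] at hB
  obtain ⟨ω, hω⟩ := Set.nonempty_compl.2 hne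
  have hle : V.b * V.P₀ B + V.a ≤ 0 := by
    rw [V.lpr_of_ne_univ hne] at hB
    exact hB ▸ le_max_left _ _
  obtain ⟨P, hP, hPB, -⟩ := V.exists_dominating (Set.disjoint_empty B) ω
    (u := 0) (v := 0) (w := V.a + V.b) le_rfl
    (mul_nonneg V.b_pos.le (V.P₀.nonneg' _)) le_rfl
    (mul_nonneg V.b_pos.le (V.P₀.nonneg' _)) V.add_nonneg
    (by rw [Set.union_empty, V.P₀.compl]; linarith) (by ring)
  exact ⟨P, hP, by rw [hPB, FinAddProb.dirac_of_notMem hω]; ring⟩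

lemma le_upr_of_dominating {P : FinAddProb Ω} (hP : ∀ C, V.lpr C ≤ P C) (C : Set Ω) :
    P C ≤ V.upr C := by
  have h := hP Cᶜ
  rw [P.compl] at h
  rw [V.upr_eq_one_sub_lpr_compl]
  linarith

/-! ### Explicit conditional natural extensions -/

lemma disjoint_inter_compl_inter (A B : Set Ω) : Disjoint (A ∩ B) (Aᶜ ∩ B) :=
  disjoint_compl_right.mono Set.inter_subset_left Set.inter_subset_left

lemma isLeast_credalValues_of_pos {A B : Set Ω} (hB : 0 < V.lpr B) (hY : (Aᶜ ∩ B).Nonempty) :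
    IsLeast (credalValues V.lpr A B)
      (V.lpr (A ∩ B) / (V.lpr (A ∩ B) + V.upr (Aᶜ ∩ B))) := by
  constructor
  · obtain ⟨P, hP, hX, hY'⟩ :=
      V.exists_dominating_eq_lpr_upr (disjoint_inter_compl_inter A B) hY
    have hPB := hB.trans_le (hP B)
    exact ⟨P, _, P.isPreciseCond_cond B hPB, hP,
      by rw [(P.isPreciseCond_cond B hPB).eq_div hPB, hX, hY']⟩
  · rintro x ⟨P, Q, h, hP, rfl⟩
    have hPB := hB.trans_le (hP B)
    rw [h.eq_div hPB]
    exact div_add_le_div_add (V.lpr_nonneg _) (hP _) (P.nonneg' _) (V.le_upr_of_dominating hP _)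
      (by rwa [P.inter_add_compl])

lemma isLeast_credalValues_of_eq_zero {A B : Set Ω} (hB : V.lpr B = 0)
    (hY : (Aᶜ ∩ B).Nonempty) : IsLeast (credalValues V.lpr A B) 0 := by
  constructor
  · obtain ⟨P, hP, hPB⟩ := V.exists_dominating_eq_zero hB
    obtain ⟨ω, hωA, hωB⟩ := hY
    exact ⟨P, _, P.isPreciseCond_dirac hPB hωB, hP, (FinAddProb.dirac_of_notMem hωA).symm⟩
  · rintro x ⟨P, Q, h, hP, rfl⟩
    exact Q.nonneg' A

lemma credalValues_nonempty {A B : Set Ω} (hB : B.Nonempty) :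
    (credalValues V.lpr A B).Nonempty := by
  rcases (V.lpr_nonneg B).eq_or_lt with h | h
  · obtain ⟨P, hP, hPB⟩ := V.exists_dominating_eq_zero h.symm
    obtain ⟨ω, hω⟩ := hB
    exact ⟨_, P, _, P.isPreciseCond_dirac hPB hω, hP, rfl⟩
  · obtain ⟨P, hP, -⟩ := V.exists_dominating_eq_lpr_upr (Set.empty_disjoint B) hB
    exact ⟨_, P, _, P.isPreciseCond_cond B (h.trans_le (hP B)), hP, rfl⟩

lemma inter_nonempty_of_dilates {A B : Set Ω} (hB : B.Nonempty) (hA : V.upr A < V.upe A B) :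
    (A ∩ B).Nonempty := by
  by_contra h
  rw [Set.not_nonempty_iff_eq_empty] at h
  have : V.upe A B ≤ 0 := csSup_le (V.credalValues_nonempty hB) (by
    rintro x ⟨P, Q, hQ, hP, rfl⟩
    rw [← hQ.inter_right, h, Q.apply_empty])
  linarith [V.upr_nonneg A]

lemma compl_inter_nonempty_of_dilates {A B : Set Ω} (hB : B.Nonempty)
    (hA : V.lpe A B < V.lpr A) (hA' : V.lpr A ≤ V.upr A) : (Aᶜ ∩ B).Nonempty := by
  by_contra h
  rw [Set.not_nonempty_iff_eq_empty] at h
  have : 1 ≤ V.lpe A B := le_csInf (V.credalValues_nonempty hB) (by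
    rintro x ⟨P, Q, hQ, hP, rfl⟩
    have h₁ := Q.compl A
    rw [← hQ.inter_right, h, Q.apply_empty] at h₁
    linarith)
  linarith [V.upr_le_one A]

lemma lpe_of_pos {A B : Set Ω} (hB : 0 < V.lpr B) (hY : (Aᶜ ∩ B).Nonempty) :
    V.lpe A B = V.lpr (A ∩ B) / (V.lpr (A ∩ B) + V.upr (Aᶜ ∩ B)) :=
  (V.isLeast_credalValues_of_pos hB hY).csInf_eq

lemma lpr_add_upr_pos {A B : Set Ω} (hB : 0 < V.lpr B) (hY : (Aᶜ ∩ B).Nonempty) :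
    0 < V.lpr (A ∩ B) + V.upr (Aᶜ ∩ B) := by
  obtain ⟨P, hP, hX, hY'⟩ := V.exists_dominating_eq_lpr_upr (disjoint_inter_compl_inter A B) hY
  rw [← hX, ← hY', P.inter_add_compl]
  exact hB.trans_le (hP B)

lemma upr_add_lpr_pos {A B : Set Ω} (hB : 0 < V.lpr B) (hX : (A ∩ B).Nonempty) :
    0 < V.upr (A ∩ B) + V.lpr (Aᶜ ∩ B) := by
  have h := V.lpr_add_upr_pos (A := Aᶜ) hB (by rwa [compl_compl])
  rwa [compl_compl, add_comm] at h

lemma upe_of_pos {A B : Set Ω} (hB : 0 < V.lpr B) (hX : (A ∩ B).Nonempty) :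
    V.upe A B = V.upr (A ∩ B) / (V.upr (A ∩ B) + V.lpr (Aᶜ ∩ B)) := by
  refine (isGreatest_credalValues_of_compl ?_).csSup_eq
  have h := V.isLeast_credalValues_of_pos (A := Aᶜ) hB (by rwa [compl_compl])
  rw [compl_compl] at h
  convert h using 1
  have := V.upr_add_lpr_pos hB hX
  rw [add_comm (V.lpr _), one_sub_div this.ne']
  ring

lemma lpe_of_eq_zero {A B : Set Ω} (hB : V.lpr B = 0) (hY : (Aᶜ ∩ B).Nonempty) :
    V.lpe A B = 0 := (V.isLeast_credalValues_of_eq_zero hB hY).csInf_eq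

lemma upe_of_eq_zero {A B : Set Ω} (hB : V.lpr B = 0) (hX : (A ∩ B).Nonempty) :
    V.upe A B = 1 := by
  refine (isGreatest_credalValues_of_compl ?_).csSup_eq
  rw [sub_self]
  exact V.isLeast_credalValues_of_eq_zero hB (by rwa [compl_compl])

lemma lpe_nonneg (A B : Set Ω) : 0 ≤ V.lpe A B :=
  Real.sInf_nonneg (by rintro x ⟨P, Q, -, -, rfl⟩; exact Q.nonneg' A)

lemma upe_le_one (A B : Set Ω) : V.upe A B ≤ 1 :=
  Real.sSup_le (by rintro x ⟨P, Q, -, -, rfl⟩; exact Q.le_one A) zero_le_one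

/-! ### Imprecision width on the atoms -/

lemma lpr_of_pos_of_ne_univ {C : Set Ω} (h : C ≠ Set.univ) (hpos : 0 < V.lpr C) :
    V.lpr C = V.b * V.P₀ C + V.a := by
  rw [V.lpr_of_ne_univ h] at hpos ⊢
  rcases lt_max_iff.1 hpos with h | h
  · exact max_eq_left h.le
  · exact absurd h (lt_irrefl _)

/-- Since `P₀ X ≤ 1 - P₀ Y`, positivity of `b * P₀ X + a` keeps `b * P₀ Y + c` below the barrier 1.
-/
lemma upr_of_lpr_pos_disjoint {X Y : Set Ω} (hXY : Disjoint X Y) (hY : Y.Nonempty)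
    (hX : 0 < V.lpr X) : V.upr Y = V.b * V.P₀ Y + V.c := by
  have hne : X ≠ Set.univ := by
    rintro rfl
    exact hY.ne_empty (Set.univ_disjoint.1 hXY)
  rw [V.lpr_of_pos_of_ne_univ hne hX] at hX
  rw [V.upr_of_nonempty hY]
  refine min_eq_left ?_
  have h := V.P₀.mono hXY.subset_compl_right
  rw [V.P₀.compl] at h
  have := mul_le_mul_of_nonneg_left h V.b_pos.le
  unfold c
  linarith

/-- With no barrier active, both fractions have denominator `b * P₀ B + a + c`, and their numerators
differ by `c - a`. -/
lemma upe_sub_lpe_of_lpr_pos {A B : Set Ω} (hB : 0 < V.lpr B) (hX : 0 < V.lpr (A ∩ B))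
    (hY : 0 < V.lpr (Aᶜ ∩ B)) (hX' : (A ∩ B).Nonempty) (hY' : (Aᶜ ∩ B).Nonempty) :
    V.upe A B - V.lpe A B = (V.c - V.a) / (V.b * V.P₀ B + V.a + V.c) ∧
      0 < V.b * V.P₀ B + V.a + V.c := by
  have hd := disjoint_inter_compl_inter A B
  have hXu : A ∩ B ≠ Set.univ := by
    intro h; rw [h] at hd; exact hY'.ne_empty (Set.univ_disjoint.1 hd)
  have hYu : Aᶜ ∩ B ≠ Set.univ := by
    intro h; rw [h] at hd; exact hX'.ne_empty (Set.disjoint_univ.1 hd)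
  have e := V.P₀.inter_add_compl A B
  have hpos := V.lpr_add_upr_pos hB hY'
  rw [V.upe_of_pos hB hX', V.lpe_of_pos hB hY']
  rw [V.upr_of_lpr_pos_disjoint hd hY' hX, V.lpr_of_pos_of_ne_univ hXu hX] at *
  rw [V.upr_of_lpr_pos_disjoint hd.symm hX' hY, V.lpr_of_pos_of_ne_univ hYu hY]
  have e₁ : V.b * V.P₀ (A ∩ B) + V.a + (V.b * V.P₀ (Aᶜ ∩ B) + V.c) =
      V.b * V.P₀ B + V.a + V.c := by rw [← e]; ring
  have e₂ : V.b * V.P₀ (A ∩ B) + V.c + (V.b * V.P₀ (Aᶜ ∩ B) + V.a) =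
      V.b * V.P₀ B + V.a + V.c := by rw [← e]; ring
  rw [e₁] at hpos
  refine ⟨?_, hpos⟩
  rw [e₁, e₂, ← sub_div]
  congr 1
  ring

section Dilation

variable {V} {A : Set Ω} {𝔅 : Set (Set Ω)}

lemma StrictlyDilates.inter_nonempty (hdil : V.StrictlyDilates 𝔅 A)
    (h𝔅 : Setoid.IsPartition 𝔅) {B : Set Ω} (hB : B ∈ 𝔅) :
    (A ∩ B).Nonempty ∧ (Aᶜ ∩ B).Nonempty := by
  obtain ⟨h₁, h₂, h₃⟩ := hdil B hB
  have hne := Setoid.nonempty_of_mem_partition h𝔅 hB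
  exact ⟨V.inter_nonempty_of_dilates hne h₃, V.compl_inter_nonempty_of_dilates hne h₁ h₂⟩

lemma StrictlyDilates.upe_sub_lpe_of_mem_plusAtoms (hdil : V.StrictlyDilates 𝔅 A)
    (h𝔅 : Setoid.IsPartition 𝔅) {B : Set Ω} (hB : B ∈ V.plusAtoms A 𝔅) :
    V.upe A B - V.lpe A B = (V.c - V.a) / (V.b * V.P₀ B + V.a + V.c) ∧
      0 < V.b * V.P₀ B + V.a + V.c := by
  obtain ⟨⟨hB𝔅, hpos⟩, ⟨hl, -⟩, -, hu⟩ := hB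
  obtain ⟨hX, hY⟩ := hdil.inter_nonempty h𝔅 hB𝔅
  refine V.upe_sub_lpe_of_lpr_pos hpos ((V.lpr_nonneg _).lt_of_ne' fun h => ?_)
    ((V.lpr_nonneg _).lt_of_ne' fun h => ?_) hX hY
  · rw [V.lpe_of_pos hpos hY, h, zero_div] at hl
    exact lt_irrefl _ hl
  · have h' := V.upr_add_lpr_pos hpos hX
    rw [V.upe_of_pos hpos hX, h, add_zero] at hu
    rw [h, add_zero] at h'
    rw [div_self h'.ne'] at hu
    exact lt_irrefl _ hu

lemma StrictlyDilates.upe_of_pos (hdil : V.StrictlyDilates 𝔅 A) (h𝔅 : Setoid.IsPartition 𝔅)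
    {B : Set Ω} (hB : B ∈ V.posAtoms 𝔅) :
    0 < V.upr (A ∩ B) ∧ V.upe A B = 1 / (1 + V.lpr (Aᶜ ∩ B) / V.upr (A ∩ B)) := by
  obtain ⟨hX, -⟩ := hdil.inter_nonempty h𝔅 hB.1
  have e := V.upe_of_pos hB.2 hX
  have hpos : 0 < V.upr (A ∩ B) := by
    refine (V.upr_nonneg _).lt_of_ne' fun h => ?_
    rw [h, zero_div] at e
    linarith [(hdil B hB.1).2.2, V.upr_nonneg A]
  exact ⟨hpos, by rw [e, one_add_div hpos.ne', one_div_div]⟩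

lemma StrictlyDilates.one_sub_lpe_of_pos (hdil : V.StrictlyDilates 𝔅 A)
    (h𝔅 : Setoid.IsPartition 𝔅) {B : Set Ω} (hB : B ∈ V.posAtoms 𝔅) :
    0 < V.upr (Aᶜ ∩ B) ∧ 1 - V.lpe A B = 1 / (1 + V.lpr (A ∩ B) / V.upr (Aᶜ ∩ B)) := by
  obtain ⟨-, hY⟩ := hdil.inter_nonempty h𝔅 hB.1
  have e := V.lpe_of_pos hB.2 hY
  have hs := V.lpr_add_upr_pos hB.2 hY
  have hpos : 0 < V.upr (Aᶜ ∩ B) := by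
    refine (V.upr_nonneg _).lt_of_ne' fun h => ?_
    rw [h, add_zero] at hs
    rw [h, add_zero, div_self hs.ne'] at e
    linarith [(hdil B hB.1).1, (hdil B hB.1).2.1, V.upr_le_one A]
  refine ⟨hpos, ?_⟩
  rw [e, one_add_div hpos.ne', one_div_div, one_sub_div hs.ne', add_comm (V.upr _)]
  ring

end Dilation

lemma ratios₀_nonneg {A : Set Ω} {𝔅 : Set (Set Ω)} {r : ℝ} (hr : r ∈ V.ratios₀ A 𝔅) : 0 ≤ r := by
  obtain ⟨B, -, rfl⟩ := hr
  exact div_nonneg (V.lpr_nonneg _) (V.upr_nonneg _)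

lemma ratios₁_nonneg {A : Set Ω} {𝔅 : Set (Set Ω)} {r : ℝ} (hr : r ∈ V.ratios₁ A 𝔅) : 0 ≤ r := by
  obtain ⟨B, -, rfl⟩ := hr
  exact div_nonneg (V.lpr_nonneg _) (V.upr_nonneg _)

end VBM

/-! ### The extent of dilation -/

lemma le_of_le_one_div_one_add {r t : ℝ} (hr : 0 ≤ r) (ht : 0 < t) (h : t ≤ 1 / (1 + r)) :
    r ≤ 1 / t := by
  have := (le_one_div ht (by linarith)).1 h
  linarith

/-- Boundedness of `S` is not needed: a positive `t` bounds `S` by `1 / t - 1`, and otherwise the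
claim is trivial. -/
lemma le_one_div_one_add_sSup {S : Set ℝ} (hS : S.Nonempty) (h₀ : ∀ r ∈ S, 0 ≤ r) {t : ℝ}
    (h : ∀ r ∈ S, t ≤ 1 / (1 + r)) : t ≤ 1 / (1 + sSup S) := by
  have hs : 0 ≤ sSup S := Real.sSup_nonneg h₀
  rcases le_or_gt t 0 with ht | ht
  · exact ht.trans (by positivity)
  · rw [le_one_div ht (by positivity)]
    have : sSup S ≤ 1 / t - 1 := csSup_le hS fun r hr => by
      have := (le_one_div ht (by linarith [h₀ r hr])).1 (h r hr)
      linarith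
    linarith

theorem theorem2 {Ω : Type*} (V : VBM Ω) (𝔅 : Set (Set Ω)) (h𝔅 : Setoid.IsPartition 𝔅)
    (A : Set Ω) (hdil : V.StrictlyDilates 𝔅 A) :
    ((V.plusAtoms A 𝔅).Nonempty → ∃ Bstar, V.IsPlusMax A 𝔅 Bstar) ∧
    BddAbove (V.ratios₀ A 𝔅) ∧ BddAbove (V.ratios₁ A 𝔅) ∧
    (∀ B ∈ V.zeroAtoms A 𝔅, 0 < V.upr (A ∩ B)) ∧
    (∀ B ∈ V.oneAtoms A 𝔅, 0 < V.upr (Aᶜ ∩ B)) ∧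
    ∀ Bstar, ((V.plusAtoms A 𝔅).Nonempty → V.IsPlusMax A 𝔅 Bstar) →
      ∃ m, IsLeast (V.extentTerms A 𝔅 Bstar) m ∧
        V.extentOfDilation A 𝔅 = V.lpr A - V.upr A + m := by
  have hbdd₀ : BddAbove (V.ratios₀ A 𝔅) := by
    -- Dilation gives `upr A < 1 / (1 + ratio)`, and `upr A > 0` because it exceeds some `lpe A B`.
    refine ⟨1 / V.upr A, ?_⟩
    rintro _ ⟨B, hB, rfl⟩
    obtain ⟨h₁, h₂, h₃⟩ := hdil B hB.1.1
    refine le_of_le_one_div_one_add (V.ratios₀_nonneg ⟨B, hB, rfl⟩)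
      (by linarith [V.lpe_nonneg A B]) ?_
    rw [← (hdil.upe_of_pos h𝔅 hB.1).2]
    exact h₃.le
  have hbdd₁ : BddAbove (V.ratios₁ A 𝔅) := by
    refine ⟨1 / (1 - V.lpr A), ?_⟩
    rintro _ ⟨B, hB, rfl⟩
    obtain ⟨h₁, h₂, h₃⟩ := hdil B hB.1.1
    refine le_of_le_one_div_one_add (V.ratios₁_nonneg ⟨B, hB, rfl⟩)
      (by linarith [V.upe_le_one A B]) ?_
    rw [← (hdil.one_sub_lpe_of_pos h𝔅 hB.1).2]
    linarith
  refine ⟨?_, hbdd₀, hbdd₁, fun B hB => (hdil.upe_of_pos h𝔅 hB.1).1,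
    fun B hB => (hdil.one_sub_lpe_of_pos h𝔅 hB.1).1, ?_⟩
  · rintro ⟨B, hB⟩
    obtain ⟨Bstar, h⟩ := V.P₀.exists_max_of_pairwiseDisjoint
      (S := V.plusAtoms A 𝔅) (h𝔅.pairwiseDisjoint.subset fun B hB => hB.1.1) ⟨B, hB, by
        refine (V.P₀.nonneg' _).lt_of_ne' fun h => ?_
        obtain ⟨⟨hB𝔅, hpos⟩, -⟩ := hB
        have hne : B ≠ Set.univ := by
          rintro rfl
          rw [V.P₀.univ'] at h
          exact one_ne_zero h
        rw [V.lpr_of_pos_of_ne_univ hne hpos, h] at hpos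
        linarith [V.a_nonpos]⟩
    exact ⟨Bstar, h⟩
  intro Bstar hstar
  have hfin : (V.extentTerms A 𝔅 Bstar).Finite := by
    refine Set.Finite.subset (s := {1, V.upe A Bstar - V.lpe A Bstar, 1 / (1 + V.M₀ A 𝔅),
      1 / (1 + V.M₁ A 𝔅)}) (Set.toFinite _) ?_
    rintro t (h | h | h | h)
    · simp [h]
    · simp [h.2]
    · simp [h.2]
    · simp [h.2]
  obtain ⟨m, hm, hmin⟩ := Set.exists_min_image _ id hfin ⟨1, Or.inl rfl⟩
  refine ⟨m, ⟨hm, hmin⟩, ?_⟩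
  have h𝔅ne : Nonempty 𝔅 := by
    obtain ⟨ω⟩ := V.P₀.nonempty
    obtain ⟨B, ⟨hB, -⟩, -⟩ := h𝔅.2 ω
    exact ⟨⟨B, hB⟩⟩
  have lower : ∀ B ∈ 𝔅, m ≤ V.upe A B - V.lpe A B := by
    intro B hB
    obtain ⟨h₁, h₂, h₃⟩ := hdil B hB
    obtain ⟨hX, hY⟩ := hdil.inter_nonempty h𝔅 hB
    have hone : m ≤ 1 := hmin 1 (Or.inl rfl)
    rcases (V.lpr_nonneg B).eq_or_lt with hz | hpos
    · rw [V.upe_of_eq_zero hz.symm hX, V.lpe_of_eq_zero hz.symm hY, sub_zero]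
      exact hone
    have hBp : B ∈ V.posAtoms 𝔅 := ⟨hB, hpos⟩
    have hl1 : V.lpe A B < 1 := by linarith [V.upr_le_one A]
    have hu0 : 0 < V.upe A B := by linarith [V.upr_nonneg A]
    -- Dilation excludes `lpe = 1` and `upe = 0`, so the cases are the vacuous one and the three
    -- classes.
    rcases (V.lpe_nonneg A B).eq_or_lt with hl | hl <;>
      rcases (V.upe_le_one A B).eq_or_lt with hu | hu
    · rwa [← hl, hu, sub_zero]
    · have hmem : B ∈ V.zeroAtoms A 𝔅 := ⟨hBp, hl.symm, hu0, hu⟩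
      refine (hmin _ (Or.inr (Or.inr (Or.inl ⟨⟨B, hmem⟩, rfl⟩)))).trans ?_
      rw [← hl, sub_zero, (hdil.upe_of_pos h𝔅 hBp).2]
      have hr : V.lpr (Aᶜ ∩ B) / V.upr (A ∩ B) ∈ V.ratios₀ A 𝔅 := ⟨B, hmem, rfl⟩
      exact one_div_le_one_div_of_le (by linarith [V.ratios₀_nonneg hr])
        (add_le_add_right (le_csSup hbdd₀ hr) 1)
    · have hmem : B ∈ V.oneAtoms A 𝔅 := ⟨hBp, ⟨hl, hl1⟩, hu⟩
      refine (hmin _ (Or.inr (Or.inr (Or.inr ⟨⟨B, hmem⟩, rfl⟩)))).trans ?_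
      rw [hu, (hdil.one_sub_lpe_of_pos h𝔅 hBp).2]
      have hr : V.lpr (A ∩ B) / V.upr (Aᶜ ∩ B) ∈ V.ratios₁ A 𝔅 := ⟨B, hmem, rfl⟩
      exact one_div_le_one_div_of_le (by linarith [V.ratios₁_nonneg hr])
        (add_le_add_right (le_csSup hbdd₁ hr) 1)
    · have hmem : B ∈ V.plusAtoms A 𝔅 := ⟨hBp, ⟨hl, hl1⟩, hu0, hu⟩
      obtain ⟨hs, hmax⟩ := hstar ⟨B, hmem⟩
      refine (hmin _ (Or.inr (Or.inl ⟨⟨B, hmem⟩, rfl⟩))).trans ?_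
      obtain ⟨e₁, -⟩ := hdil.upe_sub_lpe_of_mem_plusAtoms h𝔅 hs
      obtain ⟨e₂, p₂⟩ := hdil.upe_sub_lpe_of_mem_plusAtoms h𝔅 hmem
      simp only [id]
      rw [e₁, e₂]
      refine div_le_div_of_nonneg_left (by linarith [V.c_nonneg, V.a_nonpos]) p₂ ?_
      linarith [mul_le_mul_of_nonneg_left (hmax B hmem) V.b_pos.le]
  have hbelow : BddBelow (Set.range fun B : 𝔅 => V.imprecisionVariation A B) := by
    refine ⟨m - (V.upr A - V.lpr A), ?_⟩
    rintro _ ⟨B, rfl⟩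
    exact sub_le_sub_right (lower B B.2) _
  have upper : ∀ B ∈ 𝔅,
      V.extentOfDilation A 𝔅 + (V.upr A - V.lpr A) ≤ V.upe A B - V.lpe A B := fun B hB =>
    le_sub_iff_add_le.1 (ciInf_le hbelow ⟨B, hB⟩)
  refine le_antisymm ?_ (le_ciInf fun B => ?_)
  · suffices h : V.extentOfDilation A 𝔅 + (V.upr A - V.lpr A) ≤ m by linarith
    -- Each term is an upper bound for the extent: 1 bounds every width, the second term is the
    -- width at `Bstar`, and the last two are infima of widths.
    rcases hm with rfl | ⟨hne, rfl⟩ | ⟨hne, rfl⟩ | ⟨hne, rfl⟩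
    · obtain ⟨B⟩ := h𝔅ne
      linarith [upper B B.2, V.upe_le_one A B, V.lpe_nonneg A B]
    · exact upper _ (hstar hne).1.1.1
    · refine le_one_div_one_add_sSup (hne.image _) (fun r => V.ratios₀_nonneg) ?_
      rintro _ ⟨B, hB, rfl⟩
      have h := upper B hB.1.1
      rwa [hB.2.1, sub_zero, (hdil.upe_of_pos h𝔅 hB.1).2] at h
    · refine le_one_div_one_add_sSup (hne.image _) (fun r => V.ratios₁_nonneg) ?_
      rintro _ ⟨B, hB, rfl⟩
      have h := upper B hB.1.1
      rwa [hB.2.2, (hdil.one_sub_lpe_of_pos h𝔅 hB.1).2] at h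
  · have h := lower B B.2
    unfold VBM.imprecisionVariation
    linarith
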